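/- Let $k \ge 1$ be an integer. Let $W_k$ be the complex threefold obtained from two copies of $\mathbb{C}^3$, with coordinates $(z,x_1,x_2)$ and $(w,y_1,y_2)$, by the coordinate change $$w = \frac1z,\qquad y_1 = z^2x_1 + z x_2^k,\qquad y_2 = x_2 \qquad (z \neq 0),$$ and let the null section of $W_k$ be the curve given by $x_1=x_2=0$ in the first copy and by $y_1=y_2=0$ in the second one. In $\mathbb{C}^4$ with coordinates $(z_1,\dots,z_4)$ consider $$S_k=\{z_1-iz_2=z_3-z_4^k=0\},\qquad Y_k=\{z_1^2+z_2^2+z_3^2-z_4^{2k}=0\}.$$ Then $S_k$ is a smooth complex surface. Let $f_k : N_k\to\mathbb{C}^4$ be the blow-up with centre $S_k$, and let the strict transform of $Y_k$ be the closure of $f_k^{-1}(Y_k\setminus S_k)$ in $N_k$. Then: 1. the origin is a singular point of $Y_k$, and the only one (a point of $Y_k$ is singular if $Y_k$ is not a complex submanifold of $\mathbb{C}^4$ near it); 2. $W_k$ is the strict transform of $Y_k$, with its null section equal to the fibre $f_k^{-1}(0)$: there is a holomorphic embedding $\Phi : W_k\to N_k$ (a holomorphic immersion that is a homeomorphism onto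 its image) whose image is the strict transform of $Y_k$ and which maps the null section of $W_k$ onto $f_k^{-1}(0)$. -/

import Mathlib

open scoped Manifold ContDiff Topology
open Set Topology

noncomputable section

/-! ### Gluing two copies of a space along an open partial homeomorphism -/

section Gluing

variable {H : Type} [TopologicalSpace H]

/-- Two points of the disjoint union of two copies of `H` are identified when they are equal, or
when one is a point `x` of the first copy lying in `e.source` and the other is the point `e x` of
the second copy. -/
def glueRel (e : OpenPartialHomeomorph H H) : H ⊕ H → H ⊕ H → Prop
  | .inl x, .inl y => x = y
  | .inl x, .inr y => x ∈ e.source ∧ e x = y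
  | .inr y, .inl x => x ∈ e.source ∧ e x = y
  | .inr x, .inr y => x = y

theorem glueRel_equivalence (e : OpenPartialHomeomorph H H) : Equivalence (glueRel e) where
  refl p := by rcases p with x | x <;> rfl
  symm {p q} h := by
    rcases p with x | x <;> rcases q with y | y
    · exact Eq.symm h
    · exact h
    · exact h
    · exact Eq.symm h
  trans {p q r} h h' := by
    rcases p with x | x <;> rcases q with y | y <;> rcases r with z | z <;>
      simp only [glueRel] at h h' ⊢
    · exact h.trans h'
    · exact h ▸ h'
    · exact e.injOn h.1 h'.1 (h.2.trans h'.2.symm)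
    · exact ⟨h.1, h.2.trans h'⟩
    · exact h' ▸ h
    · exact h.2.symm.trans h'.2
    · exact ⟨h'.1, h'.2.trans h.symm⟩
    · exact h.trans h'

/-- The setoid of the identification `glueRel e`. -/
def glueSetoid (e : OpenPartialHomeomorph H H) : Setoid (H ⊕ H) := ⟨glueRel e, glueRel_equivalence e⟩

/-- The space obtained from two copies of `H` by identifying `x ∈ e.source` in the first copy with
`e x ∈ e.target` in the second copy, with the quotient topology. -/
def Glued (e : OpenPartialHomeomorph H H) : Type := Quotient (glueSetoid e)

instance (e : OpenPartialHomeomorph H H) : TopologicalSpace (Glued e) :=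
  inferInstanceAs (TopologicalSpace (Quotient (glueSetoid e)))

namespace Glued

variable (e : OpenPartialHomeomorph H H)

/-- The projection of the disjoint union to the glued space. -/
def proj (p : H ⊕ H) : Glued e := Quotient.mk (glueSetoid e) p

/-- The first copy of `H` in the glued space. -/
def ι₀ (x : H) : Glued e := proj e (.inl x)

/-- The second copy of `H` in the glued space. -/
def ι₁ (x : H) : Glued e := proj e (.inr x)

variable {e}

theorem proj_eq_iff {p q : H ⊕ H} : proj e p = proj e q ↔ glueRel e p q :=
  Quotient.eq (r := glueSetoid e)

theorem ι₀_eq_ι₁_iff {x y : H} : ι₀ e x = ι₁ e y ↔ x ∈ e.source ∧ e x = y := proj_eq_iff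

theorem ι₀_injective : Function.Injective (ι₀ e) := fun _ _ h => proj_eq_iff.1 h

theorem ι₁_injective : Function.Injective (ι₁ e) := fun _ _ h => proj_eq_iff.1 h

theorem exists_rep (p : Glued e) : (∃ x, ι₀ e x = p) ∨ ∃ y, ι₁ e y = p := by
  obtain ⟨q, rfl⟩ := Quotient.exists_rep (s := glueSetoid e) p
  rcases q with x | y
  · exact Or.inl ⟨x, rfl⟩
  · exact Or.inr ⟨y, rfl⟩

theorem isOpen_iff {s : Set (Glued e)} :
    IsOpen s ↔ IsOpen (ι₀ e ⁻¹' s) ∧ IsOpen (ι₁ e ⁻¹' s) := by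
  have h : IsOpen s ↔ IsOpen (proj e ⁻¹' s) := isQuotientMap_quotient_mk'.isOpen_preimage.symm
  rw [h, isOpen_sum_iff]
  rfl

theorem continuous_ι₀ : Continuous (ι₀ e) :=
  continuous_def.2 fun _ hs => (isOpen_iff.1 hs).1

theorem continuous_ι₁ : Continuous (ι₁ e) :=
  continuous_def.2 fun _ hs => (isOpen_iff.1 hs).2

theorem ι₁_preimage_image_ι₀ (s : Set H) : ι₁ e ⁻¹' (ι₀ e '' s) = e '' (e.source ∩ s) := by
  ext y
  simp only [mem_preimage, mem_image, ι₀_eq_ι₁_iff, mem_inter_iff]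
  constructor
  · rintro ⟨x, hx, h, rfl⟩; exact ⟨x, ⟨h, hx⟩, rfl⟩
  · rintro ⟨x, ⟨h, hx⟩, rfl⟩; exact ⟨x, hx, h, rfl⟩

theorem ι₀_preimage_image_ι₁ (s : Set H) : ι₀ e ⁻¹' (ι₁ e '' s) = e.source ∩ e ⁻¹' s := by
  ext x
  simp only [mem_preimage, mem_image, mem_inter_iff]
  constructor
  · rintro ⟨y, hy, h⟩
    obtain ⟨h1, rfl⟩ := ι₀_eq_ι₁_iff.1 h.symm
    exact ⟨h1, hy⟩
  · rintro ⟨h, hx⟩; exact ⟨e x, hx, (ι₀_eq_ι₁_iff.2 ⟨h, rfl⟩).symm⟩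

theorem isOpenEmbedding_ι₀ : IsOpenEmbedding (ι₀ e) :=
  .of_continuous_injective_isOpenMap continuous_ι₀ ι₀_injective fun s hs => isOpen_iff.2
    ⟨by rwa [ι₀_injective.preimage_image], by
      rw [ι₁_preimage_image_ι₀]; exact e.isOpen_image_source_inter hs⟩

theorem isOpenEmbedding_ι₁ : IsOpenEmbedding (ι₁ e) :=
  .of_continuous_injective_isOpenMap continuous_ι₁ ι₁_injective fun s hs => isOpen_iff.2
    ⟨by rw [ι₀_preimage_image_ι₁]; exact e.isOpen_inter_preimage hs,
      by rwa [ι₁_injective.preimage_image]⟩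

variable (e) in
/-- The coordinates on the first copy of `H`: the inverse of `ι₀`. -/
def chart₀ [Nonempty H] : OpenPartialHomeomorph (Glued e) H :=
  (isOpenEmbedding_ι₀.toOpenPartialHomeomorph (ι₀ e)).symm

variable (e) in
/-- The coordinates on the second copy of `H`: the inverse of `ι₁`. -/
def chart₁ [Nonempty H] : OpenPartialHomeomorph (Glued e) H :=
  (isOpenEmbedding_ι₁.toOpenPartialHomeomorph (ι₁ e)).symm

open Classical in
/-- The atlas of the glued space consists of the two coordinate systems. -/
instance [Nonempty H] : ChartedSpace H (Glued e) where
  atlas := {chart₀ e, chart₁ e}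
  chartAt p := if p ∈ range (ι₀ e) then chart₀ e else chart₁ e
  mem_chart_source p := by
    split_ifs with h
    · simpa [chart₀] using h
    · simpa [chart₁] using (exists_rep p).resolve_left h
  chart_mem_atlas p := by split_ifs <;> simp

/-- The glued space is Hausdorff if the graph of the gluing map is closed. -/
theorem t2Space [T2Space H] (h : IsClosed {p : H × H | p.1 ∈ e.source ∧ e p.1 = p.2}) :
    T2Space (Glued e) := by
  have key : ∀ x y, ι₀ e x ≠ ι₁ e y →
      ∃ u v : Set (Glued e), IsOpen u ∧ IsOpen v ∧ ι₀ e x ∈ u ∧ ι₁ e y ∈ v ∧ Disjoint u v := by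
    intro x y hne
    have hxy : (x, y) ∈ {p : H × H | p.1 ∈ e.source ∧ e p.1 = p.2}ᶜ := fun hm =>
      hne (ι₀_eq_ι₁_iff.2 hm)
    obtain ⟨u, v, hu, hv, hx, hy, huv⟩ := isOpen_prod_iff.1 h.isOpen_compl x y hxy
    refine ⟨ι₀ e '' u, ι₁ e '' v, isOpenEmbedding_ι₀.isOpenMap u hu,
      isOpenEmbedding_ι₁.isOpenMap v hv, mem_image_of_mem _ hx, mem_image_of_mem _ hy,
      disjoint_left.2 ?_⟩
    rintro _ ⟨a, ha, rfl⟩ ⟨b, hb, hab⟩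
    exact huv (mk_mem_prod ha hb) (ι₀_eq_ι₁_iff.1 hab.symm)
  refine ⟨fun p q hpq => ?_⟩
  rcases exists_rep p with ⟨x, rfl⟩ | ⟨x, rfl⟩ <;> rcases exists_rep q with ⟨y, rfl⟩ | ⟨y, rfl⟩
  · obtain ⟨u, v, hu, hv, hx, hy, huv⟩ := t2_separation (fun hxy : x = y => hpq (hxy ▸ rfl))
    exact ⟨_, _, isOpenEmbedding_ι₀.isOpenMap u hu, isOpenEmbedding_ι₀.isOpenMap v hv,
      mem_image_of_mem _ hx, mem_image_of_mem _ hy, (disjoint_image_iff ι₀_injective).2 huv⟩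
  · exact key x y hpq
  · obtain ⟨u, v, hu, hv, hx, hy, huv⟩ := key y x hpq.symm
    exact ⟨v, u, hv, hu, hy, hx, huv.symm⟩
  · obtain ⟨u, v, hu, hv, hx, hy, huv⟩ := t2_separation (fun hxy : x = y => hpq (hxy ▸ rfl))
    exact ⟨_, _, isOpenEmbedding_ι₁.isOpenMap u hu, isOpenEmbedding_ι₁.isOpenMap v hv,
      mem_image_of_mem _ hx, mem_image_of_mem _ hy, (disjoint_image_iff ι₁_injective).2 huv⟩

end Glued

end Gluing

/-- Gluing along a biholomorphic map between open sets gives a complex manifold. -/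
theorem Glued.isManifold {E : Type} [NormedAddCommGroup E] [NormedSpace ℂ E]
    {e : OpenPartialHomeomorph E E} (h : ContDiffOn ℂ ω e e.source)
    (h' : ContDiffOn ℂ ω e.symm e.target) : IsManifold 𝓘(ℂ, E) ω (Glued e) := by
  have hs₀ : ∀ x, (Glued.chart₀ e).symm x = Glued.ι₀ e x := fun x => rfl
  have hs₁ : ∀ x, (Glued.chart₁ e).symm x = Glued.ι₁ e x := fun x => rfl
  have h₀ : ∀ x, Glued.chart₀ e (Glued.ι₀ e x) = x := fun x =>
    Glued.isOpenEmbedding_ι₀.toOpenPartialHomeomorph_left_inv (Glued.ι₀ e)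
  have h₁ : ∀ x, Glued.chart₁ e (Glued.ι₁ e x) = x := fun x =>
    Glued.isOpenEmbedding_ι₁.toOpenPartialHomeomorph_left_inv (Glued.ι₁ e)
  have src₀ : (Glued.chart₀ e).source = range (Glued.ι₀ e) := by simp [Glued.chart₀]
  have src₁ : (Glued.chart₁ e).source = range (Glued.ι₁ e) := by simp [Glued.chart₁]
  refine isManifold_of_contDiffOn _ _ _ fun c d hc hd => ?_
  simp only [modelWithCornersSelf_coe, modelWithCornersSelf_coe_symm, Function.id_comp,
    Function.comp_id, preimage_id, range_id, inter_univ]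
  rcases hc with rfl | rfl <;> rcases hd with rfl | rfl
  · exact contDiffOn_id.congr fun x _ => by simp [hs₀, h₀]
  · refine (h.mono fun x hx => ?_).congr fun x hx => ?_ <;>
    · have hx2 : Glued.ι₀ e x ∈ range (Glued.ι₁ e) := by
        rw [← src₁]; exact hx.2
      obtain ⟨y, hy⟩ := hx2
      obtain ⟨ha, hb⟩ := Glued.ι₀_eq_ι₁_iff.1 hy.symm
      first
        | exact ha
        | simp [hs₀, ← hy, h₁, hb]
  · have aux : ∀ y, Glued.ι₁ e y ∈ range (Glued.ι₀ e) →
        y ∈ e.target ∧ Glued.ι₁ e y = Glued.ι₀ e (e.symm y) := by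
      rintro y ⟨x, hx⟩
      obtain ⟨ha, rfl⟩ := Glued.ι₀_eq_ι₁_iff.1 hx
      exact ⟨e.map_source ha, by rw [← hx, e.left_inv ha]⟩
    have hm : ∀ y, y ∈ ((Glued.chart₁ e).symm.trans (Glued.chart₀ e)).source →
        Glued.ι₁ e y ∈ range (Glued.ι₀ e) := fun y hy => by
      rw [← src₀]; exact hy.2
    refine (h'.mono fun y hy => (aux y (hm y hy)).1).congr fun y hy => ?_
    simp [hs₁, (aux y (hm y hy)).2, h₀]
  · exact contDiffOn_id.congr fun x _ => by simp [hs₁, h₁]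

/-! ### The threefold `W_k` -/

/-- The coordinate change `(z, x₁, x₂) ↦ (w, y₁, y₂)` of `W_k`, defined where `z ≠ 0`:
`w = 1 / z`, `y₁ = z² x₁ + z x₂ᵏ`, `y₂ = x₂`. -/
def transitionW (k : ℕ) : OpenPartialHomeomorph (ℂ × ℂ × ℂ) (ℂ × ℂ × ℂ) where
  toFun p := (p.1⁻¹, p.1 ^ 2 * p.2.1 + p.1 * p.2.2 ^ k, p.2.2)
  invFun q := (q.1⁻¹, q.1 ^ 2 * q.2.1 - q.1 * q.2.2 ^ k, q.2.2)
  source := {p | p.1 ≠ 0}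
  target := {q | q.1 ≠ 0}
  map_source' _ hp := inv_ne_zero hp
  map_target' _ hq := inv_ne_zero hq
  left_inv' p hp := by
    have hp : p.1 ≠ 0 := hp
    ext <;> simp
    field_simp
    ring
  right_inv' q hq := by
    have hq : q.1 ≠ 0 := hq
    ext <;> simp
    field_simp
    ring
  open_source := isOpen_ne_fun continuous_fst continuous_const
  open_target := isOpen_ne_fun continuous_fst continuous_const
  continuousOn_toFun :=
    (continuousOn_fst.inv₀ fun _ hp => hp).prodMk (by fun_prop)
  continuousOn_invFun :=
    (continuousOn_fst.inv₀ fun _ hq => hq).prodMk (by fun_prop)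

/-- The threefold `W_k`: two copies of `ℂ³` glued by the coordinate change `transitionW k`. -/
abbrev W (k : ℕ) : Type := Glued (transitionW k)

instance (k : ℕ) : IsManifold 𝓘(ℂ, ℂ × ℂ × ℂ) ω (W k) :=
  Glued.isManifold
    ((contDiffOn_fst.inv fun _ hp => hp).prodMk (ContDiff.contDiffOn (by fun_prop)))
    ((contDiffOn_fst.inv fun _ hp => hp).prodMk (ContDiff.contDiffOn (by fun_prop)))

instance (k : ℕ) : T2Space (W k) := by
  refine Glued.t2Space ?_
  have : {p : (ℂ × ℂ × ℂ) × (ℂ × ℂ × ℂ) |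
      p.1 ∈ (transitionW k).source ∧ transitionW k p.1 = p.2} =
      {p | p.1.1 * p.2.1 = 1 ∧ p.1.1 ^ 2 * p.1.2.1 + p.1.1 * p.1.2.2 ^ k = p.2.2.1 ∧
        p.1.2.2 = p.2.2.2} := by
    ext ⟨⟨z, x₁, x₂⟩, w, y₁, y₂⟩
    change (z ≠ 0 ∧ (z⁻¹, z ^ 2 * x₁ + z * x₂ ^ k, x₂) = (w, y₁, y₂)) ↔ (z * w = 1 ∧ _ ∧ _)
    simp only [Prod.mk.injEq]
    constructor
    · rintro ⟨h, rfl, h1, h2⟩; exact ⟨mul_inv_cancel₀ h, h1, h2⟩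
    · rintro ⟨h, h1, h2⟩
      exact ⟨left_ne_zero_of_mul_eq_one h, (eq_inv_of_mul_eq_one_right h).symm, h1, h2⟩
  rw [this]
  exact (isClosed_eq (by fun_prop) (by fun_prop)).inter
    ((isClosed_eq (by fun_prop) (by fun_prop)).inter (isClosed_eq (by fun_prop) (by fun_prop)))

/-- The null section of `W_k`: the points with `x₁ = x₂ = 0` in the first coordinates, or with
`y₁ = y₂ = 0` in the second ones. -/
def nullSection (k : ℕ) : Set (W k) :=
  Glued.ι₀ (transitionW k) '' {p | p.2.1 = 0 ∧ p.2.2 = 0} ∪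
    Glued.ι₁ (transitionW k) '' {q | q.2.1 = 0 ∧ q.2.2 = 0}

/-! ### Submanifolds and singular points of subsets of a complex vector space -/

section Submanifold

variable {E : Type} [NormedAddCommGroup E] [NormedSpace ℂ E]

/-- Near `p`, the set `Y` is a complex submanifold of dimension `d`: some biholomorphic map from a
neighbourhood of `p` to an open subset of `E` carries `Y` to a linear subspace of dimension `d`. -/
def IsComplexSubmanifoldAt (d : ℕ) (Y : Set E) (p : E) : Prop :=
  ∃ (φ : OpenPartialHomeomorph E E) (L : Submodule ℂ E),
    p ∈ φ.source ∧ ContDiffOn ℂ ω φ φ.source ∧ ContDiffOn ℂ ω φ.symm φ.target ∧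
    Module.finrank ℂ L = d ∧ ∀ z ∈ φ.source, z ∈ Y ↔ φ z ∈ L

/-- The singular points of an analytic set `Y`: the points of `Y` near which `Y` is not a complex
submanifold, of any dimension. -/
def singularPoints (Y : Set E) : Set E :=
  {p ∈ Y | ¬ ∃ d : ℕ, IsComplexSubmanifoldAt d Y p}

end Submanifold

/-! ### The blow-up of a complex fourfold along a smooth surface -/

/-- The coordinate change of the blow-up of `ℂ⁴`, with coordinates `(x₁, x₂, y₁, y₂)`, along the
plane `x₁ = x₂ = 0`. The blow-up is the set of all `(x, y, ℓ)` with `ℓ` a line through the origin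
of `ℂ²` that contains `x`. The coordinates `(s, x₂, y)` parametrize the points
`(s x₂, x₂, y, [s : 1])`, and the coordinates `(t, x₁, y)` the points `(x₁, t x₁, y, [1 : t])`. -/
def transitionBl : OpenPartialHomeomorph (ℂ × ℂ × ℂ × ℂ) (ℂ × ℂ × ℂ × ℂ) where
  toFun p := (p.1⁻¹, p.1 * p.2.1, p.2.2)
  invFun q := (q.1⁻¹, q.1 * q.2.1, q.2.2)
  source := {p | p.1 ≠ 0}
  target := {q | q.1 ≠ 0}
  map_source' _ hp := inv_ne_zero hp
  map_target' _ hq := inv_ne_zero hq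
  left_inv' p hp := by
    have hp : p.1 ≠ 0 := hp
    ext <;> simp [hp]
  right_inv' q hq := by
    have hq : q.1 ≠ 0 := hq
    ext <;> simp [hq]
  open_source := isOpen_ne_fun continuous_fst continuous_const
  open_target := isOpen_ne_fun continuous_fst continuous_const
  continuousOn_toFun :=
    (continuousOn_fst.inv₀ fun _ hp => hp).prodMk (by fun_prop)
  continuousOn_invFun :=
    (continuousOn_fst.inv₀ fun _ hq => hq).prodMk (by fun_prop)

/-- The blow-up of `ℂ⁴ = {(x₁, x₂, y₁, y₂)}` along the plane `x₁ = x₂ = 0`, as a complex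
manifold. -/
abbrev Bl : Type := Glued transitionBl

instance : IsManifold 𝓘(ℂ, ℂ × ℂ × ℂ × ℂ) ω Bl :=
  Glued.isManifold
    ((contDiffOn_fst.inv fun _ hp => hp).prodMk (ContDiff.contDiffOn (by fun_prop)))
    ((contDiffOn_fst.inv fun _ hp => hp).prodMk (ContDiff.contDiffOn (by fun_prop)))

instance : T2Space Bl := by
  refine Glued.t2Space ?_
  have : {p : (ℂ × ℂ × ℂ × ℂ) × (ℂ × ℂ × ℂ × ℂ) |
      p.1 ∈ transitionBl.source ∧ transitionBl p.1 = p.2} =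
      {p | p.1.1 * p.2.1 = 1 ∧ p.1.1 * p.1.2.1 = p.2.2.1 ∧ p.1.2.2 = p.2.2.2} := by
    ext ⟨⟨s, c, y⟩, t, a, y'⟩
    change (s ≠ 0 ∧ (s⁻¹, s * c, y) = (t, a, y')) ↔ (s * t = 1 ∧ _ ∧ _)
    simp only [Prod.mk.injEq]
    constructor
    · rintro ⟨h, rfl, h1, h2⟩; exact ⟨mul_inv_cancel₀ h, h1, h2⟩
    · rintro ⟨h, h1, h2⟩
      exact ⟨left_ne_zero_of_mul_eq_one h, (eq_inv_of_mul_eq_one_right h).symm, h1, h2⟩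
  rw [this]
  exact (isClosed_eq (by fun_prop) (by fun_prop)).inter
    ((isClosed_eq (by fun_prop) (by fun_prop)).inter (isClosed_eq (by fun_prop) (by fun_prop)))

/-- The blow-down map `Bl → ℂ⁴` in the two coordinate systems of `Bl`:
`(s, x₂, y) ↦ (s x₂, x₂, y)` and `(t, x₁, y) ↦ (x₁, t x₁, y)`. -/
def blowDown : Bl → ℂ × ℂ × ℂ × ℂ :=
  Quotient.lift
    (Sum.elim (fun p => (p.1 * p.2.1, p.2.1, p.2.2)) (fun q => (q.2.1, q.1 * q.2.1, q.2.2))) (by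
      rintro (p | p) (q | q) h
      · obtain rfl : p = q := h
        rfl
      · obtain ⟨hp, rfl⟩ := h
        have hp : p.1 ≠ 0 := hp
        simp [transitionBl, hp]
      · obtain ⟨hq, rfl⟩ := h
        have hq : q.1 ≠ 0 := hq
        simp [transitionBl, hq]
      · obtain rfl : p = q := h
        rfl)

/-- `f : N → E` is a blow-up of the four-dimensional complex vector space `E` with centre the
smooth surface `S`. Every point of `E` has a neighbourhood with holomorphic coordinates
`φ = (x₁, x₂, y₁, y₂)` in which `S` is `x₁ = x₂ = 0`, and over this neighbourhood `f` is
biholomorphic, compatibly with `φ`, to the blow-up of `ℂ⁴` along `x₁ = x₂ = 0`.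
(At a point outside of a closed `S` this says that `f` is biholomorphic over a neighbourhood.) -/
def IsBlowUp {E : Type} [NormedAddCommGroup E] [NormedSpace ℂ E]
    {N : Type} [TopologicalSpace N] [ChartedSpace (ℂ × ℂ × ℂ × ℂ) N]
    (S : Set E) (f : N → E) : Prop :=
  ∀ p : E, ∃ (φ : OpenPartialHomeomorph E (ℂ × ℂ × ℂ × ℂ)) (Ψ : OpenPartialHomeomorph N Bl),
    p ∈ φ.source ∧ ContDiffOn ℂ ω φ φ.source ∧ ContDiffOn ℂ ω φ.symm φ.target ∧
    (∀ z ∈ φ.source, z ∈ S ↔ (φ z).1 = 0 ∧ (φ z).2.1 = 0) ∧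
    Ψ.source = f ⁻¹' φ.source ∧ Ψ.target = blowDown ⁻¹' φ.target ∧
    ContMDiffOn 𝓘(ℂ, ℂ × ℂ × ℂ × ℂ) 𝓘(ℂ, ℂ × ℂ × ℂ × ℂ) ω Ψ Ψ.source ∧
    ContMDiffOn 𝓘(ℂ, ℂ × ℂ × ℂ × ℂ) 𝓘(ℂ, ℂ × ℂ × ℂ × ℂ) ω Ψ.symm Ψ.target ∧
    ∀ x ∈ Ψ.source, blowDown (Ψ x) = φ (f x)

/-- The strict transform of `Y` by a blow-up `f` with centre `S`. -/
def strictTransform {E N : Type} [TopologicalSpace N] (f : N → E) (S Y : Set E) : Set N :=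
  closure (f ⁻¹' (Y \ S))

/-! ### The surface `S_k`, the hypersurface `Y_k` and the blow-up `f_k : N_k → ℂ⁴` -/

/-- The surface `S_k = {z₁ - i z₂ = z₃ - z₄ᵏ = 0}` of `ℂ⁴`. The coordinates `z₁, …, z₄` are
`z 0, …, z 3`. -/
def surfaceS (k : ℕ) : Set (Fin 4 → ℂ) :=
  {z | z 0 - Complex.I * z 1 = 0 ∧ z 2 - z 3 ^ k = 0}

/-- The hypersurface `Y_k = {z₁² + z₂² + z₃² - z₄²ᵏ = 0}` of `ℂ⁴`. -/
def hypersurfaceY (k : ℕ) : Set (Fin 4 → ℂ) :=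
  {z | z 0 ^ 2 + z 1 ^ 2 + z 2 ^ 2 - z 3 ^ (2 * k) = 0}

/-- The biholomorphic map `ℂ⁴ → ℂ⁴`, `z ↦ (z₁ - i z₂, z₃ - z₄ᵏ, z₁ + i z₂, z₄)`, which carries
`S_k` to the plane where the first two coordinates vanish. -/
def adaptedCoord (k : ℕ) : (Fin 4 → ℂ) ≃ₜ ℂ × ℂ × ℂ × ℂ where
  toFun z := (z 0 - Complex.I * z 1, z 2 - z 3 ^ k, z 0 + Complex.I * z 1, z 3)
  invFun q := ![(q.1 + q.2.2.1) / 2, Complex.I * (q.1 - q.2.2.1) / 2,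
    q.2.1 + q.2.2.2 ^ k, q.2.2.2]
  left_inv z := by
    ext i
    fin_cases i
    · simp
    · simp only [Fin.mk_one, Matrix.cons_val_one, Matrix.cons_val_zero]
      linear_combination (-z 1) * Complex.I_sq
    · simp
    · simp
  right_inv q := by
    ext <;> simp
    · linear_combination ((q.2.2.1 - q.1) / 2) * Complex.I_sq
    · linear_combination ((q.1 - q.2.2.1) / 2) * Complex.I_sq
  continuous_toFun := by fun_prop
  continuous_invFun := by
    refine continuous_pi fun i => ?_
    fin_cases i <;> simp <;> fun_prop

/-- The blow-up `f_k : N_k → ℂ⁴` with centre `S_k`: in the coordinates `adaptedCoord k` of `ℂ⁴` it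
is the blow-up of `ℂ⁴` along a coordinate plane, so the complex manifold `N_k` is `Bl`. -/
def blowUpMap (k : ℕ) (x : Bl) : Fin 4 → ℂ := (adaptedCoord k).symm (blowDown x)

end

/-!
In the coordinates `(u, v, p, q) = (z₁ - i z₂, z₃ - z₄ᵏ, z₁ + i z₂, z₄)` of `ℂ⁴`, the surface `S_k`
is the plane `u = v = 0` and the hypersurface `Y_k` is `u p + v (v + 2 qᵏ) = 0`. Hence `S_k` is
smooth, and the blow-up along `S_k` is the standard blow-up along a plane.

*Singular points.* The differential of the equation of `Y_k` vanishes in the origin only, and away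
from the origin the inverse function theorem straightens `Y_k`
(`isComplexSubmanifoldAt_of_hasFDerivAt_ne_zero`). If `Y_k` were a submanifold near the origin, its
tangent space there would contain the velocities of all curves in `Y_k`. These span `ℂ⁴`, so `Y_k`
would be a neighbourhood of the origin (`IsComplexSubmanifoldAt.mem_nhds_of_span_eq_top`), which it
is not.

*Strict transform.* In the chart `u = s v` of the blow-up the equation of `Y_k` becomes
`v (s p + v + 2 qᵏ) = 0`, and in the chart `v = t u` it becomes `u (p + t (t u + 2 qᵏ)) = 0`. The
second factors define a smooth closed threefold. Solving them for `v` and for `p` parametrizes it by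
`(s, p, q)` and `(t, u, q)`, where `t = 1 / s` and `u = - s² p - 2 s qᵏ`; with `z = s`,
`x₁ = p / 2`, `x₂ = q` and `w = t`, `y₁ = -u / 2`, `y₂ = q` this is the coordinate change of `W_k`.
The resulting map `strictTransformParam` is an embedding with closed image, because the second
factors are coordinates of the two charts (`Glued.isImmersion_map`, `Glued.isEmbedding_map`). Off
`f_k⁻¹(S_k)` the first factors do not vanish, so the image contains `f_k⁻¹(Y_k \ S_k)`, and the
points of `W_k` where they do not vanish are dense, so the image is the closure.
-/

/-! ### Complex submanifolds: regular zero sets and tangent vectors -/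

section Submanifold

variable {E : Type} [NormedAddCommGroup E] [NormedSpace ℂ E]

/-- The zero set of a holomorphic function is a complex submanifold near every point where the
differential does not vanish. -/
theorem isComplexSubmanifoldAt_of_hasFDerivAt_ne_zero [CompleteSpace E] {F : E → ℂ} {p : E}
    {F' : E →L[ℂ] ℂ} (hF : ContDiff ℂ ω F) (hF' : HasFDerivAt F F' p) (h0 : F' ≠ 0) :
    ∃ d, IsComplexSubmanifoldAt d {z | F z = 0} p := by
  obtain ⟨v, hv⟩ : ∃ v, F' v = 1 := by
    obtain ⟨u, hu⟩ : ∃ u, F' u ≠ 0 := by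
      by_contra! h
      exact h0 (ContinuousLinearMap.ext h)
    exact ⟨(F' u)⁻¹ • u, by simp [hu]⟩
  -- As `F' v = 1`, this map satisfies `F' ∘ φ = F`, and its differential at `p` is the identity.
  let φ : E → E := fun z => z + (F z - F' z) • v
  have hφ : ContDiff ℂ ω φ :=
    contDiff_id.add ((hF.sub F'.contDiff).smul contDiff_const)
  have hφ' : HasFDerivAt φ ((ContinuousLinearEquiv.refl ℂ E : E ≃L[ℂ] E) : E →L[ℂ] E) p := by
    convert! (hasFDerivAt_id p).add ((hF'.sub F'.hasFDerivAt).smul_const v) using 1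
    ext x
    simp
  have hω : (ω : WithTop ℕ∞) ≠ 0 := by simp
  let e := hφ.contDiffAt.toOpenPartialHomeomorph φ hφ' hω
  have hp : p ∈ e.source := hφ.contDiffAt.mem_toOpenPartialHomeomorph_source hφ' hω
  have hsymm : ContDiffAt ℂ ω e.symm (φ p) :=
    e.contDiffAt_symm (f₀' := ContinuousLinearEquiv.refl ℂ E) (e.map_source hp)
      (by rw [show φ p = e p from rfl, e.left_inv hp]; exact hφ')
      (by rw [show φ p = e p from rfl, e.left_inv hp]; exact hφ.contDiffAt)
  have hω' : (ω : WithTop ℕ∞) ≠ ∞ := by simp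
  refine ⟨_, e.restrContDiff ℂ ω hω', LinearMap.ker (F' : E →ₗ[ℂ] ℂ), ⟨hp, hφ.contDiffAt, hsymm⟩,
    e.contDiffOn_restrContDiff_source ℂ hω', e.contDiffOn_restrContDiff_target ℂ hω', rfl,
    fun z _ => ?_⟩
  change F z = 0 ↔ F' (z + (F z - F' z) • v) = 0
  simp [hv]

/-- If `Y` is a complex submanifold near `p` and the velocities at `p` of curves in `Y` span the
ambient space, then `Y` is a neighbourhood of `p`: in coordinates that carry `Y` to a linear
subspace `L`, those velocities lie in `L`. -/
theorem IsComplexSubmanifoldAt.mem_nhds_of_span_eq_top [FiniteDimensional ℂ E] {d : ℕ}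
    {Y : Set E} {p : E} (h : IsComplexSubmanifoldAt d Y p) (hp : p ∈ Y) {T : Set E}
    (hT : Submodule.span ℂ T = ⊤)
    (hc : ∀ v ∈ T, ∃ γ : ℂ → E, HasDerivAt γ v 0 ∧ γ 0 = p ∧ ∀ t, γ t ∈ Y) : Y ∈ 𝓝 p := by
  obtain ⟨φ, L, hpφ, hφ, hφs, -, hY⟩ := h
  have hA : DifferentiableAt ℂ φ p :=
    (hφ.contDiffAt (φ.open_source.mem_nhds hpφ)).differentiableAt (by simp)
  have hB : DifferentiableAt ℂ φ.symm (φ p) :=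
    (hφs.contDiffAt (φ.open_target.mem_nhds (φ.map_source hpφ))).differentiableAt (by simp)
  have hAB : ∀ w, fderiv ℂ φ p (fderiv ℂ φ.symm (φ p) w) = w := by
    have hA' : HasFDerivAt φ (fderiv ℂ φ p) (φ.symm (φ p)) := by
      rw [φ.left_inv hpφ]; exact hA.hasFDerivAt
    have h1 := hA'.comp (φ p) hB.hasFDerivAt
    have h2 : HasFDerivAt (φ ∘ φ.symm) (ContinuousLinearMap.id ℂ E) (φ p) :=
      (hasFDerivAt_id (φ p)).congr_of_eventuallyEq
        (φ.eventually_right_inverse (φ.map_source hpφ))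
    exact fun w => DFunLike.congr_fun (h1.unique h2) w
  have hTL : T ⊆ L.comap (fderiv ℂ φ p : E →ₗ[ℂ] E) := by
    intro v hv
    obtain ⟨γ, hγ, hγ0, hγY⟩ := hc v hv
    have hφγ : HasDerivAt (φ ∘ γ) (fderiv ℂ φ p v) 0 := by
      refine HasFDerivAt.comp_hasDerivAt 0 ?_ hγ
      rw [hγ0]; exact hA.hasFDerivAt
    refine (Submodule.closed_of_finiteDimensional L).mem_of_tendsto hφγ.tendsto_slope ?_
    have hev : ∀ᶠ t in 𝓝 (0 : ℂ), γ t ∈ φ.source :=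
      hγ.continuousAt.eventually_mem (φ.open_source.mem_nhds (by rwa [hγ0]))
    filter_upwards [nhdsWithin_le_nhds hev] with t ht
    refine L.smul_mem _ (L.sub_mem ((hY _ ht).1 (hγY t)) ?_)
    rw [Function.comp_apply, hγ0]
    exact (hY p hpφ).1 hp
  have hL : ∀ w, w ∈ L := fun w => by
    have : fderiv ℂ φ.symm (φ p) w ∈ L.comap (fderiv ℂ φ p : E →ₗ[ℂ] E) :=
      Submodule.span_le.2 hTL (hT ▸ Submodule.mem_top)
    simpa [hAB] using this
  exact Filter.mem_of_superset (φ.open_source.mem_nhds hpφ) fun z hz => (hY z hz).2 (hL _)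

end Submanifold

/-! ### Maps between glued spaces -/

namespace Glued

section Map

variable {H H' : Type} [TopologicalSpace H] [TopologicalSpace H']
  {e : OpenPartialHomeomorph H H} {e' : OpenPartialHomeomorph H' H'} {a b : H → H'}

theorem isClosed_iff {s : Set (Glued e)} :
    IsClosed s ↔ IsClosed (ι₀ e ⁻¹' s) ∧ IsClosed (ι₁ e ⁻¹' s) := by
  simp only [← isOpen_compl_iff, isOpen_iff, preimage_compl]

/-- The map of glued spaces given by `a` on the first copies and by `b` on the second ones. The
hypothesis `h` says that `a` and `b` agree on the overlap, and that `a` maps the overlap of the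
source to the overlap of the target. -/
def map (h : ∀ x ∈ e.source, a x ∈ e'.source ∧ e' (a x) = b (e x)) : Glued e → Glued e' :=
  Quotient.lift (Sum.elim (fun x => ι₀ e' (a x)) (fun y => ι₁ e' (b y))) (by
    rintro (x | x) (y | y) hxy
    · obtain rfl : x = y := hxy
      rfl
    · obtain ⟨hx, rfl⟩ := hxy
      exact ι₀_eq_ι₁_iff.2 (h x hx)
    · obtain ⟨hy, rfl⟩ := hxy
      exact (ι₀_eq_ι₁_iff.2 (h y hy)).symm
    · obtain rfl : x = y := hxy
      rfl)

variable (h : ∀ x ∈ e.source, a x ∈ e'.source ∧ e' (a x) = b (e x))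

@[simp]
theorem map_ι₀ (x : H) : map h (ι₀ e x) = ι₀ e' (a x) := rfl

@[simp]
theorem map_ι₁ (y : H) : map h (ι₁ e y) = ι₁ e' (b y) := rfl

theorem continuous_map (ha : Continuous a) (hb : Continuous b) : Continuous (map h) :=
  continuous_def.2 fun _ hs => isOpen_iff.2
    ⟨(isOpen_iff.1 hs).1.preimage ha, (isOpen_iff.1 hs).2.preimage hb⟩

variable {h}

theorem mem_range_ι₀_of_map (hb : ∀ y, b y ∈ e'.target → y ∈ e.target) {q : Glued e}
    (hq : map h q ∈ range (ι₀ e')) : q ∈ range (ι₀ e) := by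
  rcases exists_rep q with ⟨x, rfl⟩ | ⟨y, rfl⟩
  · exact mem_range_self x
  · obtain ⟨x, hx⟩ := hq
    obtain ⟨hx, hxy⟩ := ι₀_eq_ι₁_iff.1 hx
    have hy : y ∈ e.target := hb y (hxy ▸ e'.map_source hx)
    exact ⟨e.symm y, ι₀_eq_ι₁_iff.2 ⟨e.map_target hy, e.right_inv hy⟩⟩

theorem mem_range_ι₁_of_map (ha : ∀ x, a x ∈ e'.source → x ∈ e.source) {q : Glued e}
    (hq : map h q ∈ range (ι₁ e')) : q ∈ range (ι₁ e) := by
  rcases exists_rep q with ⟨x, rfl⟩ | ⟨y, rfl⟩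
  · obtain ⟨y, hy⟩ := hq
    have hx : x ∈ e.source := ha x (ι₀_eq_ι₁_iff.1 hy.symm).1
    exact ⟨e x, (ι₀_eq_ι₁_iff.2 ⟨hx, rfl⟩).symm⟩
  · exact mem_range_self y

theorem ι₀_preimage_range_map (hb : ∀ y, b y ∈ e'.target → y ∈ e.target) :
    ι₀ e' ⁻¹' range (map h) = range a := by
  ext x
  constructor
  · rintro ⟨q, hq⟩
    obtain ⟨x', rfl⟩ := mem_range_ι₀_of_map hb ⟨x, hq.symm⟩
    exact ⟨x', ι₀_injective hq⟩
  · rintro ⟨x', rfl⟩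
    exact ⟨ι₀ e x', rfl⟩

theorem ι₁_preimage_range_map (ha : ∀ x, a x ∈ e'.source → x ∈ e.source) :
    ι₁ e' ⁻¹' range (map h) = range b := by
  ext y
  constructor
  · rintro ⟨q, hq⟩
    obtain ⟨y', rfl⟩ := mem_range_ι₁_of_map ha ⟨y, hq.symm⟩
    exact ⟨y', ι₁_injective hq⟩
  · rintro ⟨y', rfl⟩
    exact ⟨ι₁ e y', rfl⟩

/-- Embeddings of the two copies glue to an embedding as soon as only the overlap of the source is
mapped to the overlap of the target. -/
theorem isEmbedding_map (ha : IsEmbedding a) (hb : IsEmbedding b)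
    (ha' : ∀ x, a x ∈ e'.source → x ∈ e.source) (hb' : ∀ y, b y ∈ e'.target → y ∈ e.target) :
    IsEmbedding (map h) := by
  refine ⟨isInducing_iff_nhds.2 fun p => le_antisymm
    ((continuous_map h ha.continuous hb.continuous).tendsto p).le_comap fun s hs => ?_, ?_⟩
  · obtain ⟨u, hus, hu, hpu⟩ := mem_nhds_iff.1 hs
    rcases exists_rep p with ⟨x, rfl⟩ | ⟨y, rfl⟩
    · obtain ⟨v, hv, hvu⟩ := ha.isInducing.isOpen_iff.1 (isOpen_iff.1 hu).1
      have hxv : x ∈ a ⁻¹' v := hvu ▸ hpu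
      refine ⟨ι₀ e' '' v, (isOpenEmbedding_ι₀.isOpenMap v hv).mem_nhds ⟨a x, hxv, rfl⟩, ?_⟩
      rintro q ⟨x', hx', hq⟩
      obtain ⟨x'', rfl⟩ := mem_range_ι₀_of_map hb' ⟨x', hq⟩
      obtain rfl := ι₀_injective hq
      exact hus (hvu.subset hx')
    · obtain ⟨v, hv, hvu⟩ := hb.isInducing.isOpen_iff.1 (isOpen_iff.1 hu).2
      have hyv : y ∈ b ⁻¹' v := hvu ▸ hpu
      refine ⟨ι₁ e' '' v, (isOpenEmbedding_ι₁.isOpenMap v hv).mem_nhds ⟨b y, hyv, rfl⟩, ?_⟩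
      rintro q ⟨y', hy', hq⟩
      obtain ⟨y'', rfl⟩ := mem_range_ι₁_of_map ha' ⟨y', hq⟩
      obtain rfl := ι₁_injective hq
      exact hus (hvu.subset hy')
  · intro p q hpq
    rcases exists_rep p with ⟨x, rfl⟩ | ⟨y, rfl⟩
    · obtain ⟨x', rfl⟩ := mem_range_ι₀_of_map hb' (q := q) ⟨a x, hpq⟩
      exact congrArg _ (ha.injective (ι₀_injective hpq))
    · obtain ⟨y', rfl⟩ := mem_range_ι₁_of_map ha' (q := q) ⟨b y, hpq⟩
      exact congrArg _ (hb.injective (ι₁_injective hpq))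

end Map

end Glued

/-! ### Immersions in straightening coordinates -/

section Immersion

variable {E E' : Type} [NormedAddCommGroup E] [NormedSpace ℂ E]
  [NormedAddCommGroup E'] [NormedSpace ℂ E']

/-- A map into a complex manifold is an immersion at a point if, near that point, it becomes the
inclusion of a linear subspace after a holomorphic change of a chart of the target by a global
biholomorphic map `c`. -/
theorem isImmersionAtOfComplement_of_homeomorph {F : Type} [NormedAddCommGroup F]
    [NormedSpace ℂ F] {M N : Type} [TopologicalSpace M] [ChartedSpace E M]
    [TopologicalSpace N] [ChartedSpace E' N] [IsManifold 𝓘(ℂ, E) ω M] [IsManifold 𝓘(ℂ, E') ω N]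
    {f : M → N} {φ : OpenPartialHomeomorph M E} {ψ : OpenPartialHomeomorph N E'}
    (hφ : φ ∈ atlas E M) (hψ : ψ ∈ atlas E' N)
    (hfs : φ.source ⊆ f ⁻¹' ψ.source) (c : E' ≃ₜ E') (hc : ContDiff ℂ ω c)
    (hc' : ContDiff ℂ ω c.symm) (ℓ : (E × F) ≃L[ℂ] E')
    (hf : ∀ x ∈ φ.target, c (ψ (f (φ.symm x))) = ℓ (x, 0)) {p : M} (hp : p ∈ φ.source) :
    Manifold.IsImmersionAtOfComplement F 𝓘(ℂ, E) 𝓘(ℂ, E') ω f p := by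
  have hψ' : ψ ∈ IsManifold.maximalAtlas 𝓘(ℂ, E') ω N := IsManifold.subset_maximalAtlas hψ
  refine Manifold.IsImmersionAtOfComplement.mk_of_charts ℓ φ (ψ.transHomeomorph c) hp (hfs hp)
    (IsManifold.subset_maximalAtlas hφ) ?_ hfs fun x hx => ?_
  · refine OpenPartialHomeomorph.mem_maximalAtlas_of_contMDiffOn _ ?_ ?_
    · exact hc.contMDiff.comp_contMDiffOn (contMDiffOn_of_mem_maximalAtlas hψ')
    · exact (contMDiffOn_symm_of_mem_maximalAtlas hψ').comp hc'.contMDiff.contMDiffOn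
        fun x hx => hx
  · exact hf x (by simpa using hx)

variable {e : OpenPartialHomeomorph E E} {e' : OpenPartialHomeomorph E' E'} {a b : E → E'}

/-- A map of glued spaces is a holomorphic immersion if each of its two parts becomes the inclusion
of a linear subspace after a biholomorphic change of coordinates of the target. -/
theorem Glued.isImmersion_map [IsManifold 𝓘(ℂ, E) ω (Glued e)] [IsManifold 𝓘(ℂ, E') ω (Glued e')]
    {F : Type} [NormedAddCommGroup F] [NormedSpace ℂ F]
    (h : ∀ x ∈ e.source, a x ∈ e'.source ∧ e' (a x) = b (e x)) (ℓ : (E × F) ≃L[ℂ] E')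
    (c₀ c₁ : E' ≃ₜ E') (hc₀ : ContDiff ℂ ω c₀) (hc₀' : ContDiff ℂ ω c₀.symm)
    (hc₁ : ContDiff ℂ ω c₁) (hc₁' : ContDiff ℂ ω c₁.symm) (ha : ∀ x, c₀ (a x) = ℓ (x, 0))
    (hb : ∀ y, c₁ (b y) = ℓ (y, 0)) :
    Manifold.IsImmersion 𝓘(ℂ, E) 𝓘(ℂ, E') ω (Glued.map h) := by
  have h₀ : ∀ x, Glued.chart₀ e' (Glued.ι₀ e' x) = x := fun x =>
    Glued.isOpenEmbedding_ι₀.toOpenPartialHomeomorph_left_inv (Glued.ι₀ e')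
  have h₁ : ∀ x, Glued.chart₁ e' (Glued.ι₁ e' x) = x := fun x =>
    Glued.isOpenEmbedding_ι₁.toOpenPartialHomeomorph_left_inv (Glued.ι₁ e')
  refine ⟨F, inferInstance, inferInstance, fun p => ?_⟩
  rcases Glued.exists_rep p with ⟨x, rfl⟩ | ⟨y, rfl⟩
  · refine isImmersionAtOfComplement_of_homeomorph (φ := Glued.chart₀ e) (ψ := Glued.chart₀ e')
      (Or.inl rfl) (Or.inl rfl) ?_ c₀ hc₀ hc₀' ℓ (fun x _ => ?_) ?_
    · intro q hq
      obtain ⟨x, rfl⟩ : q ∈ range (Glued.ι₀ e) := by simpa [Glued.chart₀] using hq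
      simp [Glued.chart₀]
    · change c₀ (Glued.chart₀ e' (Glued.ι₀ e' (a x))) = _
      rw [h₀, ha]
    · simp [Glued.chart₀]
  · refine isImmersionAtOfComplement_of_homeomorph (φ := Glued.chart₁ e) (ψ := Glued.chart₁ e')
      (Or.inr rfl) (Or.inr rfl) ?_ c₁ hc₁ hc₁' ℓ (fun x _ => ?_) ?_
    · intro q hq
      obtain ⟨x, rfl⟩ : q ∈ range (Glued.ι₁ e) := by simpa [Glued.chart₁] using hq
      simp [Glued.chart₁]
    · change c₁ (Glued.chart₁ e' (Glued.ι₁ e' (b x))) = _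
      rw [h₁, hb]
    · simp [Glued.chart₁]

end Immersion

/-! ### The surface `S_k` and the blow-up along it -/

theorem contDiff_adaptedCoord (k : ℕ) : ContDiff ℂ ω (adaptedCoord k) := by
  change ContDiff ℂ ω fun z : Fin 4 → ℂ =>
    (z 0 - Complex.I * z 1, z 2 - z 3 ^ k, z 0 + Complex.I * z 1, z 3)
  fun_prop

theorem contDiff_adaptedCoord_symm (k : ℕ) : ContDiff ℂ ω (adaptedCoord k).symm := by
  change ContDiff ℂ ω fun q : ℂ × ℂ × ℂ × ℂ =>
    ![(q.1 + q.2.2.1) / 2, Complex.I * (q.1 - q.2.2.1) / 2, q.2.1 + q.2.2.2 ^ k, q.2.2.2]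
  refine contDiff_pi.2 fun i => ?_
  fin_cases i <;> simp <;> fun_prop

theorem mem_surfaceS_iff_adaptedCoord {k : ℕ} {z : Fin 4 → ℂ} :
    z ∈ surfaceS k ↔ (adaptedCoord k z).1 = 0 ∧ (adaptedCoord k z).2.1 = 0 := Iff.rfl

/-- In the adapted coordinates `(u, v, p, q)`, the hypersurface `Y_k` is `u p + v (v + 2 qᵏ) = 0`. -/
theorem mem_hypersurfaceY_iff_adaptedCoord {k : ℕ} {z : Fin 4 → ℂ} :
    z ∈ hypersurfaceY k ↔ (adaptedCoord k z).1 * (adaptedCoord k z).2.2.1 +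
      (adaptedCoord k z).2.1 * ((adaptedCoord k z).2.1 + 2 * (adaptedCoord k z).2.2.2 ^ k) = 0 := by
  change z 0 ^ 2 + z 1 ^ 2 + z 2 ^ 2 - z 3 ^ (2 * k) = 0 ↔
    (z 0 - Complex.I * z 1) * (z 0 + Complex.I * z 1) +
      (z 2 - z 3 ^ k) * (z 2 - z 3 ^ k + 2 * z 3 ^ k) = 0
  rw [show (z 0 - Complex.I * z 1) * (z 0 + Complex.I * z 1) +
      (z 2 - z 3 ^ k) * (z 2 - z 3 ^ k + 2 * z 3 ^ k) =
      z 0 ^ 2 + z 1 ^ 2 + z 2 ^ 2 - z 3 ^ (2 * k) by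
    linear_combination -(z 1) ^ 2 * Complex.I_sq]

theorem isComplexSubmanifoldAt_surfaceS (k : ℕ) (p : Fin 4 → ℂ) :
    IsComplexSubmanifoldAt 2 (surfaceS k) p := by
  let ℓ : (ℂ × ℂ × ℂ × ℂ) ≃L[ℂ] (Fin 4 → ℂ) :=
    LinearEquiv.toContinuousLinearEquiv
      { toFun := fun q => ![q.1, q.2.1, q.2.2.1, q.2.2.2]
        invFun := fun z => (z 0, z 1, z 2, z 3)
        map_add' := fun _ _ => by ext i; fin_cases i <;> simp
        map_smul' := fun _ _ => by ext i; fin_cases i <;> simp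
        left_inv := fun _ => rfl
        right_inv := fun _ => by ext i; fin_cases i <;> rfl }
  let L : Submodule ℂ (ℂ × ℂ × ℂ × ℂ) := Submodule.prod ⊥ (Submodule.prod ⊥ ⊤)
  have hL : Module.finrank ℂ L = 2 := by
    let g : L ≃ₗ[ℂ] ℂ × ℂ :=
      { toFun := fun q => q.1.2.2
        invFun := fun y => ⟨(0, 0, y), by simp [L]⟩
        map_add' := fun _ _ => rfl
        map_smul' := fun _ _ => rfl
        left_inv := fun ⟨⟨u, v, y⟩, hu, hv, _⟩ => by
          obtain rfl : u = 0 := hu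
          obtain rfl : v = 0 := hv
          rfl
        right_inv := fun _ => rfl }
    simp [g.finrank_eq]
  refine ⟨((adaptedCoord k).trans ℓ.toHomeomorph).toOpenPartialHomeomorph,
    L.map (ℓ : (ℂ × ℂ × ℂ × ℂ) →ₗ[ℂ] (Fin 4 → ℂ)), mem_univ _,
    (ℓ.contDiff.comp (contDiff_adaptedCoord k)).contDiffOn,
    ((contDiff_adaptedCoord_symm k).comp ℓ.symm.contDiff).contDiffOn, ?_, fun z _ => ?_⟩
  · rw [← hL]
    exact LinearEquiv.finrank_map_eq ℓ.toLinearEquiv L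
  · rw [mem_surfaceS_iff_adaptedCoord]
    change _ ↔ ℓ (adaptedCoord k z) ∈ Submodule.map ℓ.toLinearEquiv.toLinearMap L
    rw [Submodule.mem_map_equiv]
    change _ ↔ ℓ.symm (ℓ (adaptedCoord k z)) ∈ L
    rw [ℓ.symm_apply_apply]
    simp [L]

/-- As `N_k` is the standard blow-up, transported by the global coordinates `adaptedCoord k`, the
local models of the blow-up are restrictions of the identity map. -/
theorem isBlowUp_blowUpMap (k : ℕ) : IsBlowUp (surfaceS k) (blowUpMap k) := fun p =>
  ⟨(adaptedCoord k).toOpenPartialHomeomorph, OpenPartialHomeomorph.refl Bl, mem_univ p,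
    (contDiff_adaptedCoord k).contDiffOn, (contDiff_adaptedCoord_symm k).contDiffOn,
    fun _ _ => mem_surfaceS_iff_adaptedCoord, rfl, rfl, contMDiffOn_id, contMDiffOn_id,
    fun x _ => ((adaptedCoord k).apply_symm_apply (blowDown x)).symm⟩

/-! ### The singular point of `Y_k` -/

theorem hasFDerivAt_hypersurfaceY (k : ℕ) (p : Fin 4 → ℂ) :
    HasFDerivAt (fun z : Fin 4 → ℂ => z 0 ^ 2 + z 1 ^ 2 + z 2 ^ 2 - z 3 ^ (2 * k))
      ((2 * p 0) • ContinuousLinearMap.proj (R := ℂ) (φ := fun _ : Fin 4 => ℂ) 0 +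
        (2 * p 1) • ContinuousLinearMap.proj 1 + (2 * p 2) • ContinuousLinearMap.proj 2 -
        (2 * k * p 3 ^ (2 * k - 1)) • ContinuousLinearMap.proj 3) p := by
  have h (i : Fin 4) (n : ℕ) := (hasFDerivAt_apply (𝕜 := ℂ) i p).pow n
  convert! (((h 0 2).add (h 1 2)).add (h 2 2)).sub (h 3 (2 * k)) using 1
  ext v
  simp

theorem isComplexSubmanifoldAt_hypersurfaceY {k : ℕ} (hk : 1 ≤ k) {p : Fin 4 → ℂ} (hp : p ≠ 0) :
    ∃ d, IsComplexSubmanifoldAt d (hypersurfaceY k) p := by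
  refine isComplexSubmanifoldAt_of_hasFDerivAt_ne_zero (by fun_prop)
    (hasFDerivAt_hypersurfaceY k p) fun h => hp ?_
  have hi (i : Fin 4) := DFunLike.congr_fun h (Pi.single i 1)
  have hk0 : k ≠ 0 := by omega
  have h0 := hi 0
  have h1 := hi 1
  have h2 := hi 2
  have h3 := hi 3
  simp [hk0] at h0 h1 h2 h3
  ext i
  fin_cases i
  exacts [h0, h1, h2, h3.1]

/-- The hypersurface `Y_k` is not a submanifold near the origin. It contains the lines through the
origin spanned by isotropic vectors of `ℂ³` and the curve `t ↦ (0, 0, tᵏ, t)`, and their velocities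
at the origin span `ℂ⁴`. -/
theorem not_isComplexSubmanifoldAt_hypersurfaceY_zero {k : ℕ} (hk : 1 ≤ k) :
    ¬ ∃ d, IsComplexSubmanifoldAt d (hypersurfaceY k) 0 := by
  rintro ⟨d, h⟩
  have hk0 : k ≠ 0 := by omega
  have h0 : (0 : Fin 4 → ℂ) ∈ hypersurfaceY k := by simp [hypersurfaceY, hk0]
  let v₁ : Fin 4 → ℂ := ![1, Complex.I, 0, 0]
  let v₂ : Fin 4 → ℂ := ![1, -Complex.I, 0, 0]
  let v₃ : Fin 4 → ℂ := ![1, 0, Complex.I, 0]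
  let v₄ : Fin 4 → ℂ := ![0, 0, k * 0 ^ (k - 1), 1]
  have hT : Submodule.span ℂ {v₁, v₂, v₃, v₄} = ⊤ := by
    refine eq_top_iff.2 fun w _ => ?_
    simp only [Submodule.mem_span_insert, Submodule.mem_span_singleton]
    let c : ℂ := -Complex.I * (w 2 - w 3 * (k * 0 ^ (k - 1)))
    refine ⟨(w 0 - c - Complex.I * w 1) / 2, _, ⟨(w 0 - c + Complex.I * w 1) / 2, _,
      ⟨c, _, ⟨w 3, rfl⟩, rfl⟩, rfl⟩, ?_⟩
    ext i
    fin_cases i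
    · simp [v₁, v₂, v₃, v₄]
      ring
    · simp [v₁, v₂, v₃, v₄]
      linear_combination w 1 * Complex.I_sq
    · simp [v₁, v₂, v₃, v₄, c]
      linear_combination (w 2 - w 3 * (k * 0 ^ (k - 1))) * Complex.I_sq
    · simp [v₁, v₂, v₃, v₄]
  have line : ∀ v : Fin 4 → ℂ, v 0 ^ 2 + v 1 ^ 2 + v 2 ^ 2 = 0 → v 3 = 0 →
      ∃ γ : ℂ → Fin 4 → ℂ, HasDerivAt γ v 0 ∧ γ 0 = 0 ∧ ∀ t, γ t ∈ hypersurfaceY k := by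
    intro v hv hv3
    refine ⟨fun t => t • v, by simpa using (hasDerivAt_id (0 : ℂ)).smul_const v, zero_smul _ _,
      fun t => ?_⟩
    change (t * v 0) ^ 2 + (t * v 1) ^ 2 + (t * v 2) ^ 2 - (t * v 3) ^ (2 * k) = 0
    rw [hv3, mul_zero, zero_pow (by omega)]
    linear_combination t ^ 2 * hv
  have hY : hypersurfaceY k ∈ 𝓝 0 := by
    refine h.mem_nhds_of_span_eq_top h0 hT ?_
    rintro v (rfl | rfl | rfl | rfl)
    · exact line _ (by simp [v₁]) (by simp [v₁])
    · exact line _ (by simp [v₂]) (by simp [v₂])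
    · exact line _ (by simp [v₃]) (by simp [v₃])
    · refine ⟨fun t => ![0, 0, t ^ k, t], hasDerivAt_pi.2 fun i => ?_, ?_, fun t => ?_⟩
      · fin_cases i
        · exact hasDerivAt_const _ _
        · exact hasDerivAt_const _ _
        · exact hasDerivAt_pow k 0
        · exact hasDerivAt_id _
      · ext i
        fin_cases i <;> simp [hk0]
      · simp [hypersurfaceY]
        ring
  -- The first coordinate axis meets `Y_k` in the origin only.
  have hcont : Continuous fun t : ℂ => (Pi.single 0 t : Fin 4 → ℂ) :=
    continuous_single (A := fun _ : Fin 4 => ℂ) 0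
  have hev : ∀ᶠ t : ℂ in 𝓝 0, (Pi.single 0 t : Fin 4 → ℂ) ∈ hypersurfaceY k :=
    hcont.continuousAt.eventually_mem (by simpa using hY)
  obtain ⟨t, ht, ht0⟩ := ((hev.filter_mono nhdsWithin_le_nhds).and
    (eventually_mem_nhdsWithin (a := (0 : ℂ)) (s := {0}ᶜ))).exists
  simp [hypersurfaceY, hk0] at ht
  exact ht0 ht

theorem singularPoints_hypersurfaceY {k : ℕ} (hk : 1 ≤ k) :
    singularPoints (hypersurfaceY k) = {0} := by
  ext p
  constructor
  · rintro ⟨-, hp⟩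
    by_contra h0
    exact hp (isComplexSubmanifoldAt_hypersurfaceY hk h0)
  · rintro rfl
    exact ⟨by simp [hypersurfaceY, show k ≠ 0 by omega],
      not_isComplexSubmanifoldAt_hypersurfaceY_zero hk⟩

/-! ### The strict transform of `Y_k` -/

/-- Coordinates of `ℂ⁴` that straighten the strict transform of `Y_k` in the first copy of `ℂ⁴` in
the blow-up: there, with coordinates `(s, v, p, q)`, the pullback `s v p + v (v + 2 qᵏ)` of the
equation of `Y_k` is `v` times the last of the new coordinates. -/
noncomputable def straighten₀ (k : ℕ) : (ℂ × ℂ × ℂ × ℂ) ≃ₜ ℂ × ℂ × ℂ × ℂ where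
  toFun r := (r.1, r.2.2.1 / 2, r.2.2.2, r.1 * r.2.2.1 + r.2.1 + 2 * r.2.2.2 ^ k)
  invFun r := (r.1, r.2.2.2 - 2 * r.1 * r.2.1 - 2 * r.2.2.1 ^ k, 2 * r.2.1, r.2.2.1)
  left_inv r := by ext <;> simp <;> ring
  right_inv r := by ext <;> simp; ring
  continuous_toFun := by fun_prop
  continuous_invFun := by fun_prop

/-- Coordinates of `ℂ⁴` that straighten the strict transform of `Y_k` in the second copy of `ℂ⁴` in
the blow-up: there, with coordinates `(t, u, p, q)`, the pullback `u p + t u (t u + 2 qᵏ)` of the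
equation of `Y_k` is `u` times the last of the new coordinates. -/
noncomputable def straighten₁ (k : ℕ) : (ℂ × ℂ × ℂ × ℂ) ≃ₜ ℂ × ℂ × ℂ × ℂ where
  toFun r := (r.1, -r.2.1 / 2, r.2.2.2, r.2.2.1 + r.1 * (r.1 * r.2.1 + 2 * r.2.2.2 ^ k))
  invFun r := (r.1, -2 * r.2.1, r.2.2.2 + 2 * r.1 ^ 2 * r.2.1 - 2 * r.1 * r.2.2.1 ^ k, r.2.2.1)
  left_inv r := by ext <;> simp <;> ring
  right_inv r := by ext <;> simp; ring
  continuous_toFun := by fun_prop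
  continuous_invFun := by fun_prop

/-- The linear isomorphism `ℂ³ × ℂ → ℂ⁴` that appends a last coordinate. -/
noncomputable def appendCoord : ((ℂ × ℂ × ℂ) × ℂ) ≃L[ℂ] ℂ × ℂ × ℂ × ℂ :=
  (ContinuousLinearEquiv.prodAssoc ℂ ℂ (ℂ × ℂ) ℂ).trans
    ((ContinuousLinearEquiv.refl ℂ ℂ).prodCongr (ContinuousLinearEquiv.prodAssoc ℂ ℂ ℂ ℂ))

theorem appendCoord_apply (x : ℂ × ℂ × ℂ) (c : ℂ) :
    appendCoord (x, c) = (x.1, x.2.1, x.2.2, c) := rfl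

theorem isClosedEmbedding_symm_appendCoord (c : (ℂ × ℂ × ℂ × ℂ) ≃ₜ ℂ × ℂ × ℂ × ℂ) :
    IsClosedEmbedding fun x => c.symm (appendCoord (x, 0)) :=
  c.symm.isClosedEmbedding.comp (appendCoord.toHomeomorph.isClosedEmbedding.comp
    ⟨isEmbedding_prodMkLeft 0, by
      rw [show range (fun x : ℂ × ℂ × ℂ => (x, (0 : ℂ))) = {r | r.2 = 0} by
        ext ⟨x, c⟩; simp [eq_comm]]
      exact isClosed_eq continuous_snd continuous_const⟩)

theorem mem_range_symm_appendCoord {c : (ℂ × ℂ × ℂ × ℂ) ≃ₜ ℂ × ℂ × ℂ × ℂ} {r : ℂ × ℂ × ℂ × ℂ}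
    (hr : (c r).2.2.2 = 0) : r ∈ range fun x => c.symm (appendCoord (x, 0)) :=
  ⟨((c r).1, (c r).2.1, (c r).2.2.1), by
    change c.symm (appendCoord (((c r).1, (c r).2.1, (c r).2.2.1), 0)) = r
    rw [appendCoord_apply, ← hr]
    exact c.symm_apply_apply r⟩

theorem strictTransformParam_compat (k : ℕ) : ∀ x ∈ (transitionW k).source,
    (straighten₀ k).symm (appendCoord (x, 0)) ∈ transitionBl.source ∧
      transitionBl ((straighten₀ k).symm (appendCoord (x, 0))) =
        (straighten₁ k).symm (appendCoord (transitionW k x, 0)) := by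
  rintro ⟨z, x₁, x₂⟩ hz
  have hz : z ≠ 0 := hz
  refine ⟨hz, ?_⟩
  change (z⁻¹, z * (0 - 2 * z * x₁ - 2 * x₂ ^ k), 2 * x₁, x₂) =
    (z⁻¹, -2 * (z ^ 2 * x₁ + z * x₂ ^ k),
      0 + 2 * z⁻¹ ^ 2 * (z ^ 2 * x₁ + z * x₂ ^ k) - 2 * z⁻¹ * x₂ ^ k, x₂)
  ext
  · rfl
  · ring
  · field_simp
    ring
  · rfl

/-- The parametrization of the strict transform of `Y_k` by `W_k`:
`(z, x₁, x₂) ↦ (z, -2 z x₁ - 2 x₂ᵏ, 2 x₁, x₂)` on the first copies and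
`(w, y₁, y₂) ↦ (w, -2 y₁, 2 w² y₁ - 2 w y₂ᵏ, y₂)` on the second ones. -/
noncomputable def strictTransformParam (k : ℕ) : W k → Bl :=
  Glued.map (a := fun x => (straighten₀ k).symm (appendCoord (x, 0)))
    (b := fun y => (straighten₁ k).symm (appendCoord (y, 0))) (strictTransformParam_compat k)

theorem isSmoothEmbedding_strictTransformParam (k : ℕ) :
    Manifold.IsSmoothEmbedding 𝓘(ℂ, ℂ × ℂ × ℂ) 𝓘(ℂ, ℂ × ℂ × ℂ × ℂ) ω (strictTransformParam k) where
  isImmersion := by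
    refine Glued.isImmersion_map _ appendCoord (straighten₀ k) (straighten₁ k) ?_ ?_ ?_ ?_
      (fun x => (straighten₀ k).apply_symm_apply _) (fun y => (straighten₁ k).apply_symm_apply _)
    · change ContDiff ℂ ω fun r : ℂ × ℂ × ℂ × ℂ =>
        (r.1, r.2.2.1 / 2, r.2.2.2, r.1 * r.2.2.1 + r.2.1 + 2 * r.2.2.2 ^ k)
      fun_prop
    · change ContDiff ℂ ω fun r : ℂ × ℂ × ℂ × ℂ =>
        (r.1, r.2.2.2 - 2 * r.1 * r.2.1 - 2 * r.2.2.1 ^ k, 2 * r.2.1, r.2.2.1)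
      fun_prop
    · change ContDiff ℂ ω fun r : ℂ × ℂ × ℂ × ℂ =>
        (r.1, -r.2.1 / 2, r.2.2.2, r.2.2.1 + r.1 * (r.1 * r.2.1 + 2 * r.2.2.2 ^ k))
      fun_prop
    · change ContDiff ℂ ω fun r : ℂ × ℂ × ℂ × ℂ =>
        (r.1, -2 * r.2.1, r.2.2.2 + 2 * r.1 ^ 2 * r.2.1 - 2 * r.1 * r.2.2.1 ^ k, r.2.2.1)
      fun_prop
  isEmbedding := Glued.isEmbedding_map (isClosedEmbedding_symm_appendCoord _).isEmbedding
    (isClosedEmbedding_symm_appendCoord _).isEmbedding (fun _ hx => hx) fun _ hy => hy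

theorem isClosed_range_strictTransformParam (k : ℕ) : IsClosed (range (strictTransformParam k)) := by
  refine Glued.isClosed_iff.2 ⟨?_, ?_⟩
  · have h : Glued.ι₀ transitionBl ⁻¹' range (strictTransformParam k) =
        range fun x => (straighten₀ k).symm (appendCoord (x, 0)) :=
      Glued.ι₀_preimage_range_map fun _ hy => hy
    rw [h]
    exact (isClosedEmbedding_symm_appendCoord _).isClosed_range
  · have h : Glued.ι₁ transitionBl ⁻¹' range (strictTransformParam k) =
        range fun x => (straighten₁ k).symm (appendCoord (x, 0)) :=
      Glued.ι₁_preimage_range_map fun _ hx => hx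
    rw [h]
    exact (isClosedEmbedding_symm_appendCoord _).isClosed_range

theorem blowUpMap_mem_surfaceS_iff {k : ℕ} {x : Bl} :
    blowUpMap k x ∈ surfaceS k ↔ (blowDown x).1 = 0 ∧ (blowDown x).2.1 = 0 := by
  rw [mem_surfaceS_iff_adaptedCoord, blowUpMap, Homeomorph.apply_symm_apply]

theorem blowUpMap_mem_hypersurfaceY_iff {k : ℕ} {x : Bl} :
    blowUpMap k x ∈ hypersurfaceY k ↔ (blowDown x).1 * (blowDown x).2.2.1 +
      (blowDown x).2.1 * ((blowDown x).2.1 + 2 * (blowDown x).2.2.2 ^ k) = 0 := by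
  rw [mem_hypersurfaceY_iff_adaptedCoord, blowUpMap, Homeomorph.apply_symm_apply]

theorem preimage_hypersurfaceY_diff_subset (k : ℕ) :
    blowUpMap k ⁻¹' (hypersurfaceY k \ surfaceS k) ⊆ range (strictTransformParam k) := by
  rintro x ⟨hY, hS⟩
  rw [blowUpMap_mem_hypersurfaceY_iff] at hY
  rw [blowUpMap_mem_surfaceS_iff] at hS
  rcases Glued.exists_rep x with ⟨r, rfl⟩ | ⟨r, rfl⟩
  · change r.1 * r.2.1 * r.2.2.1 + r.2.1 * (r.2.1 + 2 * r.2.2.2 ^ k) = 0 at hY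
    change ¬(r.1 * r.2.1 = 0 ∧ r.2.1 = 0) at hS
    have hv : r.2.1 ≠ 0 := fun h => hS ⟨by rw [h, mul_zero], h⟩
    obtain ⟨x, hx⟩ := mem_range_symm_appendCoord (c := straighten₀ k) (r := r)
      (mul_left_cancel₀ hv (by
        change r.2.1 * (r.1 * r.2.2.1 + r.2.1 + 2 * r.2.2.2 ^ k) = r.2.1 * 0
        linear_combination hY))
    exact ⟨Glued.ι₀ _ x, congrArg (Glued.ι₀ transitionBl) hx⟩
  · change r.2.1 * r.2.2.1 + r.1 * r.2.1 * (r.1 * r.2.1 + 2 * r.2.2.2 ^ k) = 0 at hY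
    change ¬(r.2.1 = 0 ∧ r.1 * r.2.1 = 0) at hS
    have hu : r.2.1 ≠ 0 := fun h => hS ⟨h, by rw [h, mul_zero]⟩
    obtain ⟨y, hy⟩ := mem_range_symm_appendCoord (c := straighten₁ k) (r := r)
      (mul_left_cancel₀ hu (by
        change r.2.1 * (r.2.2.1 + r.1 * (r.1 * r.2.1 + 2 * r.2.2.2 ^ k)) = r.2.1 * 0
        linear_combination hY))
    exact ⟨Glued.ι₁ _ y, congrArg (Glued.ι₁ transitionBl) hy⟩

/-- Only finitely many `t` are excluded, as `k ≥ 1`. -/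
theorem dense_setOf_add_pow_ne_zero {k : ℕ} (hk : 1 ≤ k) (c : ℂ) :
    Dense {t : ℂ | c + t ^ k ≠ 0} := by
  have hd := (Polynomial.nthRoots k (-c)).toFinset.finite_toSet.countable.dense_compl ℂ
  refine hd.mono fun t ht => ?_
  contrapose! ht
  replace ht : c + t ^ k = 0 := not_not.1 ht
  simp only [mem_compl_iff, not_not, Finset.mem_coe, Multiset.mem_toFinset,
    Polynomial.mem_nthRoots (by omega : 0 < k)]
  linear_combination ht

theorem range_strictTransformParam {k : ℕ} (hk : 1 ≤ k) :
    range (strictTransformParam k) =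
      strictTransform (blowUpMap k) (surfaceS k) (hypersurfaceY k) := by
  refine Subset.antisymm ?_ (closure_minimal (preimage_hypersurfaceY_diff_subset k)
    (isClosed_range_strictTransformParam k))
  have hcont := (isSmoothEmbedding_strictTransformParam k).isEmbedding.continuous
  rintro _ ⟨p, rfl⟩
  rcases Glued.exists_rep p with ⟨⟨z, x₁, x₂⟩, rfl⟩ | ⟨⟨w, y₁, y₂⟩, rfl⟩
  · -- Moving `x₂` makes `v = -2 (z x₁ + x₂ᵏ)` nonzero.
    have hg : Continuous fun t : ℂ =>
        strictTransformParam k (Glued.ι₀ (transitionW k) (z, x₁, t)) :=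
      hcont.comp (Glued.continuous_ι₀.comp (by fun_prop))
    have hmaps : MapsTo (fun t => strictTransformParam k (Glued.ι₀ (transitionW k) (z, x₁, t)))
        {t | z * x₁ + t ^ k ≠ 0} (blowUpMap k ⁻¹' (hypersurfaceY k \ surfaceS k)) := by
      refine fun t ht => ⟨?_, ?_⟩
      · rw [blowUpMap_mem_hypersurfaceY_iff]
        change z * (0 - 2 * z * x₁ - 2 * t ^ k) * (2 * x₁) + (0 - 2 * z * x₁ - 2 * t ^ k) *
          (0 - 2 * z * x₁ - 2 * t ^ k + 2 * t ^ k) = 0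
        ring
      · rw [blowUpMap_mem_surfaceS_iff]
        rintro ⟨-, h⟩
        change 0 - 2 * z * x₁ - 2 * t ^ k = 0 at h
        exact ht (by linear_combination -h / 2)
    exact hmaps.closure hg (dense_setOf_add_pow_ne_zero hk (z * x₁) x₂)
  · -- Moving `y₁` makes `u = -2 y₁` nonzero.
    have hg : Continuous fun t : ℂ =>
        strictTransformParam k (Glued.ι₁ (transitionW k) (w, t, y₂)) :=
      hcont.comp (Glued.continuous_ι₁.comp (by fun_prop))
    have hmaps : MapsTo (fun t => strictTransformParam k (Glued.ι₁ (transitionW k) (w, t, y₂)))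
        {0}ᶜ (blowUpMap k ⁻¹' (hypersurfaceY k \ surfaceS k)) := by
      refine fun t ht => ⟨?_, ?_⟩
      · rw [blowUpMap_mem_hypersurfaceY_iff]
        change -2 * t * (0 + 2 * w ^ 2 * t - 2 * w * y₂ ^ k) +
          w * (-2 * t) * (w * (-2 * t) + 2 * y₂ ^ k) = 0
        ring
      · rw [blowUpMap_mem_surfaceS_iff]
        rintro ⟨h, -⟩
        change -2 * t = 0 at h
        exact ht (show t = 0 by linear_combination -h / 2)
    exact hmaps.closure hg (dense_compl_singleton (0 : ℂ) y₁)

theorem blowUpMap_eq_zero_iff {k : ℕ} (hk : 1 ≤ k) {x : Bl} :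
    blowUpMap k x = 0 ↔ blowDown x = 0 := by
  have h0 : adaptedCoord k 0 = 0 := by simp [adaptedCoord, show k ≠ 0 by omega]
  rw [blowUpMap, Homeomorph.symm_apply_eq, h0]

theorem image_nullSection_strictTransformParam {k : ℕ} (hk : 1 ≤ k) :
    strictTransformParam k '' nullSection k = blowUpMap k ⁻¹' {0} := by
  have hk0 : k ≠ 0 := by omega
  have h₀ : ∀ z : ℂ, strictTransformParam k (Glued.ι₀ _ (z, 0, 0)) =
      Glued.ι₀ transitionBl (z, 0, 0, 0) := fun z => by
    change Glued.ι₀ transitionBl (z, 0 - 2 * z * 0 - 2 * 0 ^ k, 2 * 0, 0) = _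
    simp [hk0]
  have h₁ : ∀ w : ℂ, strictTransformParam k (Glued.ι₁ _ (w, 0, 0)) =
      Glued.ι₁ transitionBl (w, 0, 0, 0) := fun w => by
    change Glued.ι₁ transitionBl (w, -2 * 0, 0 + 2 * w ^ 2 * 0 - 2 * w * 0 ^ k, 0) = _
    simp [hk0]
  ext x
  rw [mem_preimage, mem_singleton_iff, blowUpMap_eq_zero_iff hk]
  constructor
  · rintro ⟨_, ⟨⟨z, x₁, x₂⟩, ⟨hx₁, hx₂⟩, rfl⟩ | ⟨⟨w, y₁, y₂⟩, ⟨hy₁, hy₂⟩, rfl⟩, rfl⟩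
    · obtain rfl : x₁ = 0 := hx₁
      obtain rfl : x₂ = 0 := hx₂
      rw [h₀]
      change (z * 0, (0 : ℂ), (0 : ℂ), (0 : ℂ)) = 0
      simp
    · obtain rfl : y₁ = 0 := hy₁
      obtain rfl : y₂ = 0 := hy₂
      rw [h₁]
      change ((0 : ℂ), w * 0, (0 : ℂ), (0 : ℂ)) = 0
      simp
  · intro hx
    rcases Glued.exists_rep x with ⟨⟨s, v, p, q⟩, rfl⟩ | ⟨⟨t, u, p, q⟩, rfl⟩
    · change (s * v, v, p, q) = (0, 0, 0, 0) at hx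
      obtain ⟨-, rfl, rfl, rfl⟩ : _ ∧ v = 0 ∧ p = 0 ∧ q = 0 := by simpa using hx
      exact ⟨_, Or.inl ⟨(s, 0, 0), ⟨rfl, rfl⟩, rfl⟩, h₀ s⟩
    · change (u, t * u, p, q) = (0, 0, 0, 0) at hx
      obtain ⟨rfl, -, rfl, rfl⟩ : u = 0 ∧ _ ∧ p = 0 ∧ q = 0 := by simpa using hx
      exact ⟨_, Or.inr ⟨(t, 0, 0), ⟨rfl, rfl⟩, rfl⟩, h₁ t⟩

theorem propositionB (k : ℕ) (hk : 1 ≤ k) :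
    (∀ p ∈ surfaceS k, IsComplexSubmanifoldAt 2 (surfaceS k) p) ∧
    IsBlowUp (surfaceS k) (blowUpMap k) ∧
    singularPoints (hypersurfaceY k) = {0} ∧
    ∃ Φ : W k → Bl,
      Manifold.IsSmoothEmbedding 𝓘(ℂ, ℂ × ℂ × ℂ) 𝓘(ℂ, ℂ × ℂ × ℂ × ℂ) ω Φ ∧
      range Φ = strictTransform (blowUpMap k) (surfaceS k) (hypersurfaceY k) ∧
      Φ '' nullSection k = blowUpMap k ⁻¹' {0} :=
  ⟨fun p _ => isComplexSubmanifoldAt_surfaceS k p, isBlowUp_blowUpMap k,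
    singularPoints_hypersurfaceY hk, strictTransformParam k,
    isSmoothEmbedding_strictTransformParam k, range_strictTransformParam hk,
    image_nullSection_strictTransformParam hk⟩
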